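/- Let $V$ be a complex manifold and let $D\subset V$ be a free divisor, i.e. a (reduced) hypersurface such that the $\mathcal O_V$-module $\mathrm{Der}(\log D)$ of germs of holomorphic vector fields tangent to $D$ is locally free. Let $h$ be a local reduced equation of $D$ (a generator of the ideal of germs of functions vanishing on $D$), and put, at each point of $V$, $\mathcal O_D=\mathcal O_V/(h)$, $\Omega^1_D=\Omega^1_V/(h\,\Omega^1_V+\mathcal O_V\,dh)$, $\theta_D=\mathrm{Hom}_{\mathcal O_D}(\Omega^1_D,\mathcal O_D)$ and $\check\Omega^1_D=\Omega^1_V/h\,\Omega^1(\log D)$, where $\Omega^1(\log D)$ is the module of meromorphic $1$-forms $\tau$ such that $h\tau$ and $h\,d\tau$ are regular. Every element of $\theta_D$ is the restriction to $D$ of some $\chi\in\mathrm{Der}(\log D)$, i.e. is of the form $[\eta]\mapsto[\eta(\chi)]$. Then evaluation of forms on vector fields induces a well-defined perfect pairing of $\mathcal O_D$-modules $$\check\Omega^1_D\times\theta_D\longrightarrow\mathcal O_D,\qquad ([\eta],\chi)\longmapsto\chi([\eta]),$$ so that $([\eta],\chi|_D)\mapsto[\eta(\chi)]$ for $\chi\in\mathrm{Der}(\log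 D)$; that is, both induced maps $\check\Omega^1_D\to\mathrm{Hom}_{\mathcal O_D}(\theta_D,\mathcal O_D)$ and $\theta_D\to\mathrm{Hom}_{\mathcal O_D}(\check\Omega^1_D,\mathcal O_D)$ are isomorphisms. Hence $\check\Omega^1_D$ is the double dual of $\Omega^1_D$: there is an isomorphism of $\mathcal O_D$-modules $\check\Omega^1_D\cong\mathrm{Hom}_{\mathcal O_D}(\mathrm{Hom}_{\mathcal O_D}(\Omega^1_D,\mathcal O_D),\mathcal O_D)$ which sends the class of $\eta\in\Omega^1_V$ to the image of the class of $\eta$ in $\Omega^1_D$ under the canonical biduality map. (All modules are the stalks at an arbitrary point of $V$.) -/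

import Mathlib

open scoped Topology Manifold ContDiff

noncomputable section

namespace FreeDivisor

variable {E : Type*} [NormedAddCommGroup E] [NormedSpace ℂ E]

/-! ### Germs of holomorphic functions, vector fields and forms at a point of `E`

`E` is a finite-dimensional complex vector space, the local model of the ambient manifold `V`. -/

/-- The local ring `𝒪_{V,p}` of germs at `p` of holomorphic functions. -/
def HolFun (p : E) : Subring (Filter.Germ (𝓝 p) ℂ) where
  carrier := {g | ∃ f : E → ℂ, AnalyticAt ℂ f p ∧ (f : Filter.Germ (𝓝 p) ℂ) = g}
  mul_mem' := by
    rintro _ _ ⟨f, hf, rfl⟩ ⟨g, hg, rfl⟩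
    exact ⟨f * g, hf.mul hg, rfl⟩
  add_mem' := by
    rintro _ _ ⟨f, hf, rfl⟩ ⟨g, hg, rfl⟩
    exact ⟨f + g, hf.add hg, rfl⟩
  one_mem' := ⟨fun _ => 1, analyticAt_const, rfl⟩
  zero_mem' := ⟨fun _ => 0, analyticAt_const, rfl⟩
  neg_mem' := by
    rintro _ ⟨f, hf, rfl⟩
    exact ⟨-f, hf.neg, rfl⟩

/-- The germs at `p` of holomorphic maps with values in `F`, as a submodule of all germs. -/
def holGermSubmodule (F : Type*) [NormedAddCommGroup F] [NormedSpace ℂ F] (p : E) :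
    Submodule (HolFun p) (Filter.Germ (𝓝 p) F) where
  carrier := {g | ∃ f : E → F, AnalyticAt ℂ f p ∧ (f : Filter.Germ (𝓝 p) F) = g}
  add_mem' := by
    rintro _ _ ⟨f, hf, rfl⟩ ⟨g, hg, rfl⟩
    exact ⟨f + g, hf.add hg, rfl⟩
  zero_mem' := ⟨fun _ => 0, analyticAt_const, rfl⟩
  smul_mem' := by
    rintro ⟨_, f, hf, rfl⟩ _ ⟨g, hg, rfl⟩
    exact ⟨f • g, hf.smul hg, rfl⟩

/-- The `𝒪_{V,p}`-module of germs at `p` of holomorphic maps with values in `F`. -/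
def HolGerm (F : Type*) [NormedAddCommGroup F] [NormedSpace ℂ F] (p : E) : Type _ :=
  ↥(holGermSubmodule F p)

instance (F : Type*) [NormedAddCommGroup F] [NormedSpace ℂ F] (p : E) :
    AddCommGroup (HolGerm F p) :=
  inferInstanceAs (AddCommGroup ↥(holGermSubmodule F p))

instance (F : Type*) [NormedAddCommGroup F] [NormedSpace ℂ F] (p : E) :
    Module (HolFun p) (HolGerm F p) :=
  inferInstanceAs (Module (HolFun p) ↥(holGermSubmodule F p))

/-- `θ_{V,p}`: germs at `p` of holomorphic vector fields. -/
abbrev Theta (p : E) : Type _ := HolGerm E p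

/-- `Ω^k_{V,p}`: germs at `p` of holomorphic differential `k`-forms. -/
abbrev Omega (k : ℕ) (p : E) : Type _ :=
  HolGerm (E [⋀^Fin k]→L[ℂ] ℂ) p

/-- The exterior derivative `df`, as a differential `1`-form, of a function `f`. -/
def dFun (f : E → ℂ) : E → E [⋀^Fin 1]→L[ℂ] ℂ :=
  fun y => ContinuousAlternatingMap.ofSubsingleton ℂ E ℂ (0 : Fin 1) (fderiv ℂ f y)

theorem dFun_analyticAt {p : E} {f : E → ℂ} (hf : AnalyticAt ℂ f p) :
    AnalyticAt ℂ (dFun f) p := by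
  exact ((ContinuousAlternatingMap.ofSubsingletonLIE (𝕜 := ℂ) (E := E) (F := ℂ) (ι := Fin 1) 0
    ).toContinuousLinearEquiv.toContinuousLinearMap.analyticAt _).comp hf.fderiv

/-- The exterior derivative `d : 𝒪_{V,p} → Ω^1_{V,p}` on germs. -/
def d {p : E} (g : HolFun p) : Omega 1 p :=
  ⟨g.1.liftOn (fun f => (dFun f : Filter.Germ (𝓝 p) (E [⋀^Fin 1]→L[ℂ] ℂ)))
      (fun f f' hff' => Filter.Germ.coe_eq.2 (by
        filter_upwards [Filter.EventuallyEq.fderiv (𝕜 := ℂ) hff'] with y hy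
        simp only [dFun, hy])), by
    obtain ⟨_, f, hf, rfl⟩ := g
    exact ⟨dFun f, dFun_analyticAt hf, rfl⟩⟩

theorem analyticAt_bilin {F G H : Type*} [NormedAddCommGroup F] [NormedSpace ℂ F]
    [NormedAddCommGroup G] [NormedSpace ℂ G] [NormedAddCommGroup H] [NormedSpace ℂ H]
    (B : F →L[ℂ] G →L[ℂ] H) {p : E} {f : E → F} {g : E → G} (hf : AnalyticAt ℂ f p)
    (hg : AnalyticAt ℂ g p) : AnalyticAt ℂ (fun y => B (f y) (g y)) p :=
  (B.analyticAt_bilinear (f p, g p)).comp₂ hf hg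

theorem analyticAt_smulRight {F : Type*} [NormedAddCommGroup F] [NormedSpace ℂ F]
    {p : E} {f : E → E →L[ℂ] ℂ} {g : E → F} (hf : AnalyticAt ℂ f p) (hg : AnalyticAt ℂ g p) :
    AnalyticAt ℂ (fun y => (f y).smulRight (g y)) p :=
  analyticAt_bilin (ContinuousLinearMap.smulRightL ℂ E F) hf hg

/-- Evaluation `Ω^1_{V,p} × θ_{V,p} → 𝒪_{V,p}`, `(η, χ) ↦ η(χ)`, of forms on vector fields. -/
def evalForm (p : E) : Omega 1 p →ₗ[HolFun p] Theta p →ₗ[HolFun p] HolFun p :=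
  LinearMap.mk₂ (HolFun p)
    (fun η χ => ⟨Filter.Germ.map₂ (fun a v => a (fun _ => v)) η.1 χ.1, by
      obtain ⟨_, a, ha, rfl⟩ := η
      obtain ⟨_, v, hv, rfl⟩ := χ
      refine ⟨fun y => a y (fun _ => v y), ?_, rfl⟩
      exact analyticAt_bilin (ContinuousLinearMap.id ℂ (E →L[ℂ] ℂ))
        (((ContinuousAlternatingMap.ofSubsingletonLIE (𝕜 := ℂ) (E := E) (F := ℂ) (ι := Fin 1) 0
          ).symm.toContinuousLinearEquiv.toContinuousLinearMap.analyticAt _).comp ha) hv⟩)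
    (by
      rintro ⟨_, a, ha, rfl⟩ ⟨_, b, hb, rfl⟩ ⟨_, v, hv, rfl⟩
      rfl)
    (by
      rintro ⟨_, f, hf, rfl⟩ ⟨_, a, ha, rfl⟩ ⟨_, v, hv, rfl⟩
      rfl)
    (by
      rintro ⟨_, a, ha, rfl⟩ ⟨_, v, hv, rfl⟩ ⟨_, w, hw, rfl⟩
      refine Subtype.ext (Filter.Germ.coe_eq.2 (Filter.Eventually.of_forall fun y => ?_))
      exact ((ContinuousAlternatingMap.ofSubsingleton ℂ E ℂ (0 : Fin 1)).symm (a y)).map_add _ _)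
    (by
      rintro ⟨_, f, hf, rfl⟩ ⟨_, a, ha, rfl⟩ ⟨_, v, hv, rfl⟩
      refine Subtype.ext (Filter.Germ.coe_eq.2 (Filter.Eventually.of_forall fun y => ?_))
      exact ((ContinuousAlternatingMap.ofSubsingleton ℂ E ℂ (0 : Fin 1)).symm (a y)).map_smul _ _)

/-! ### Hypersurface germs and logarithmic vector fields -/

/-- The ideal of germs at `p` of holomorphic functions vanishing on the set `S`. -/
def vanishingIdeal (S : Set E) (p : E) : Ideal (HolFun p) where
  carrier := {g | ∃ f : E → ℂ, (f : Filter.Germ (𝓝 p) ℂ) = g.1 ∧ ∀ᶠ y in 𝓝 p, y ∈ S → f y = 0}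
  add_mem' := by
    rintro ⟨_, _⟩ ⟨_, _⟩ ⟨f, rfl, hf⟩ ⟨g, rfl, hg⟩
    refine ⟨f + g, rfl, ?_⟩
    filter_upwards [hf, hg] with y h1 h2 hy
    simp [h1 hy, h2 hy]
  zero_mem' := ⟨fun _ => 0, rfl, Filter.Eventually.of_forall fun _ _ => rfl⟩
  smul_mem' := by
    rintro ⟨_, u, _, rfl⟩ ⟨_, _⟩ ⟨f, rfl, hf⟩
    refine ⟨u * f, rfl, ?_⟩
    filter_upwards [hf] with y h1 hy
    simp [h1 hy]

/-- `h` is a reduced equation at `p` of `S`: near `p` the set `S` is the zero set of `h`, where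
`h ≠ 0`, and `h` generates the ideal of all germs of functions that vanish on `S`. -/
structure IsReducedEquation (S : Set E) {p : E} (h : HolFun p) : Prop where
  ne_zero : h ≠ 0
  zeroSet : ∃ f : E → ℂ, (f : Filter.Germ (𝓝 p) ℂ) = h.1 ∧ ∀ᶠ y in 𝓝 p, (y ∈ S ↔ f y = 0)
  generates : vanishingIdeal S p = Ideal.span {h}

/-- The logarithmic vector fields of an ideal `J`, those `χ` with `χ(f) ∈ J` for all `f ∈ J`. If
`J` is the ideal of `D` this is `Der(log D)_p`, the module of germs of vector fields tangent to
`D`. -/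
def derLog {p : E} (J : Ideal (HolFun p)) : Submodule (HolFun p) (Theta p) where
  carrier := {χ | ∀ f ∈ J, evalForm p (d f) χ ∈ J}
  add_mem' := by
    intro χ ψ hχ hψ f hf
    rw [map_add]
    exact J.add_mem (hχ f hf) (hψ f hf)
  zero_mem' := by
    intro f _
    rw [map_zero]
    exact J.zero_mem
  smul_mem' := by
    intro c χ hχ f hf
    rw [map_smul]
    exact J.smul_mem c (hχ f hf)

/-! ### Logarithmic forms -/

/-- `τ` represents near `p` a logarithmic `k`-form with respect to `{h = 0}`: a differential form
defined and differentiable off `{h = 0}` such that `h τ` and `h dτ` are regular, i.e. extend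
holomorphically to a neighbourhood of `p`. (As `h τ` is regular, `τ` is meromorphic.)
The values of `τ` on `{h = 0}` play no role. -/
structure IsLogForm {k : ℕ} (h : E → ℂ) (p : E) (τ : E → E [⋀^Fin k]→L[ℂ] ℂ) : Prop where
  differentiable : ∀ᶠ y in 𝓝 p, h y ≠ 0 → DifferentiableAt ℂ τ y
  regular : ∃ α : E → E [⋀^Fin k]→L[ℂ] ℂ, AnalyticAt ℂ α p ∧
    ∀ᶠ y in 𝓝 p, h y ≠ 0 → h y • τ y = α y
  regular_d : ∃ β : E → E [⋀^Fin (k + 1)]→L[ℂ] ℂ, AnalyticAt ℂ β p ∧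
    ∀ᶠ y in 𝓝 p, h y ≠ 0 → h y • extDeriv τ y = β y

theorem IsLogForm.add {k : ℕ} {h : E → ℂ} {p : E} {τ σ : E → E [⋀^Fin k]→L[ℂ] ℂ}
    (hτ : IsLogForm h p τ) (hσ : IsLogForm h p σ) : IsLogForm h p (τ + σ) := by
  obtain ⟨d1, ⟨α, hα, e1⟩, ⟨β, hβ, f1⟩⟩ := hτ
  obtain ⟨d2, ⟨α', hα', e2⟩, ⟨β', hβ', f2⟩⟩ := hσ
  refine ⟨?_, ⟨α + α', hα.add hα', ?_⟩, ⟨β + β', hβ.add hβ', ?_⟩⟩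
  · filter_upwards [d1, d2] with y a b hy using (a hy).add (b hy)
  · filter_upwards [e1, e2] with y a b hy
    simp [smul_add, a hy, b hy]
  · filter_upwards [d1, d2, f1, f2] with y a b a' b' hy
    rw [extDeriv_add (a hy) (b hy), smul_add, a' hy, b' hy, Pi.add_apply]

theorem IsLogForm.smul {k : ℕ} {h : E → ℂ} {p : E} {τ : E → E [⋀^Fin k]→L[ℂ] ℂ}
    (hτ : IsLogForm h p τ) {u : E → ℂ} (hu : AnalyticAt ℂ u p) :
    IsLogForm h p (fun y => u y • τ y) := by
  obtain ⟨d1, ⟨α, hα, e1⟩, ⟨β, hβ, f1⟩⟩ := hτ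
  have hud : ∀ᶠ y in 𝓝 p, DifferentiableAt ℂ u y :=
    hu.eventually_analyticAt.mono fun y hy => hy.differentiableAt
  refine ⟨?_, ⟨fun y => u y • α y, hu.smul hα, ?_⟩,
    ⟨fun y => u y • β y + ContinuousAlternatingMap.alternatizeUncurryFinCLM ℂ E ℂ
      ((fderiv ℂ u y).smulRight (α y)), (hu.smul hβ).add ?_, ?_⟩⟩
  · filter_upwards [d1, hud] with y a b hy using b.smul (a hy)
  · filter_upwards [e1] with y a hy
    rw [smul_comm, a hy]
  · exact ((ContinuousAlternatingMap.alternatizeUncurryFinCLM (n := k) ℂ E ℂ).analyticAt _).comp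
      (analyticAt_smulRight hu.fderiv hα)
  · filter_upwards [d1, hud, e1, f1] with y a b a' b' hy
    have : extDeriv (fun y => u y • τ y) y = u y • extDeriv τ y +
        ContinuousAlternatingMap.alternatizeUncurryFinCLM ℂ E ℂ
          ((fderiv ℂ u y).smulRight (τ y)) := by
      rw [extDeriv, fderiv_fun_smul b (a hy),
        ContinuousAlternatingMap.alternatizeUncurryFin_add,
        ContinuousAlternatingMap.alternatizeUncurryFin_smul]
      rfl
    rw [this, smul_add, smul_comm, b' hy, ← map_smul, ← a' hy]
    congr 2
    ext v
    simp [mul_left_comm]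

theorem isLogForm_of_analyticAt {k : ℕ} {h : E → ℂ} {p : E}
    {η : E → E [⋀^Fin k]→L[ℂ] ℂ} (hh : AnalyticAt ℂ h p) (hη : AnalyticAt ℂ η p) :
    IsLogForm h p η := by
  refine ⟨hη.eventually_analyticAt.mono fun y hy _ => hy.differentiableAt,
    ⟨_, hh.smul hη, Filter.Eventually.of_forall fun y _ => rfl⟩,
    ⟨_, hh.smul (((ContinuousAlternatingMap.alternatizeUncurryFinCLM (n := k) ℂ E ℂ).analyticAt _).comp
      hη.fderiv), Filter.Eventually.of_forall fun y _ => rfl⟩⟩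

theorem isLogForm_congr {k : ℕ} {h h' : E → ℂ} {p : E} {τ : E → E [⋀^Fin k]→L[ℂ] ℂ}
    (hh : h =ᶠ[𝓝 p] h') (hτ : IsLogForm h p τ) : IsLogForm h' p τ := by
  obtain ⟨d1, ⟨α, hα, e1⟩, ⟨β, hβ, f1⟩⟩ := hτ
  refine ⟨?_, ⟨α, hα, ?_⟩, ⟨β, hβ, ?_⟩⟩
  · filter_upwards [d1, hh] with y a b using b ▸ a
  · filter_upwards [e1, hh] with y a b using b ▸ a
  · filter_upwards [f1, hh] with y a b using b ▸ a

/-- `h Ω^k(log D)_p ⊆ Ω^k_{V,p}`: the germs of holomorphic forms `h τ`, `τ` a logarithmic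
`k`-form. -/
def hLogForms (k : ℕ) {p : E} (h : HolFun p) : Submodule (HolFun p) (Omega k p) where
  carrier := {η | ∃ (f : E → ℂ) (τ α : E → E [⋀^Fin k]→L[ℂ] ℂ),
    (f : Filter.Germ (𝓝 p) ℂ) = h.1 ∧ (α : Filter.Germ (𝓝 p) (E [⋀^Fin k]→L[ℂ] ℂ)) = η.1 ∧
    IsLogForm f p τ ∧ ∀ᶠ y in 𝓝 p, f y ≠ 0 → f y • τ y = α y}
  add_mem' := by
    rintro ⟨_, _⟩ ⟨_, _⟩ ⟨f, τ, α, hf, rfl, hτ, e⟩ ⟨f', τ', α', hf', rfl, hτ', e'⟩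
    have hff : f' =ᶠ[𝓝 p] f := Filter.Germ.coe_eq.1 (hf'.trans hf.symm)
    refine ⟨f, τ + τ', α + α', hf, rfl, hτ.add (isLogForm_congr hff hτ'), ?_⟩
    filter_upwards [e, e', hff] with y a b c hy
    rw [c] at b
    simp [smul_add, a hy, b hy]
  zero_mem' := by
    obtain ⟨_, f, hf, rfl⟩ := h
    refine ⟨f, 0, 0, rfl, rfl, ⟨?_, ⟨0, analyticAt_const, ?_⟩, ⟨0, analyticAt_const, ?_⟩⟩, ?_⟩
    · exact Filter.Eventually.of_forall fun y _ => differentiableAt_const _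
    · exact Filter.Eventually.of_forall fun y _ =>
        ContinuousAlternatingMap.ext fun v => mul_zero _
    · refine Filter.Eventually.of_forall fun y _ => ?_
      have : extDeriv (0 : E → E [⋀^Fin k]→L[ℂ] ℂ) y = 0 := by
        have := extDeriv_smul (x := y) (0 : ℂ) (0 : E → E [⋀^Fin k]→L[ℂ] ℂ)
        simpa using this
      simp [this]
    · exact Filter.Eventually.of_forall fun y _ =>
        ContinuousAlternatingMap.ext fun v => mul_zero _
  smul_mem' := by
    rintro ⟨_, u, hu, rfl⟩ ⟨_, _⟩ ⟨f, τ, α, hf, rfl, hτ, e⟩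
    refine ⟨f, fun y => u y • τ y, fun y => u y • α y, hf, rfl, hτ.smul hu, ?_⟩
    filter_upwards [e] with y a hy
    rw [smul_comm, a hy]

/-! ### The modules on `D`

Here `h` is a reduced equation of `D` at `p`. -/

/-- `𝒪_{D,p} = 𝒪_{V,p} / (h)`. -/
abbrev FunD {p : E} (h : HolFun p) : Type _ := HolFun p ⧸ Ideal.span {h}

/-- The submodule `h Ω^1_V + 𝒪_V dh` of `Ω^1_{V,p}`. -/
def kahlerRel {p : E} (h : HolFun p) : Submodule (HolFun p) (Omega 1 p) :=
  Ideal.span {h} • (⊤ : Submodule (HolFun p) (Omega 1 p)) ⊔ Submodule.span (HolFun p) {d h}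

/-- Kähler forms `Ω^1_{D,p} = Ω^1_{V,p} / (h Ω^1_V + 𝒪_V dh)`. -/
def KahlerD {p : E} (h : HolFun p) : Type _ := Omega 1 p ⧸ kahlerRel h

/-- `Ω̌^k_{D,p} = Ω^k_{V,p} / h Ω^k(log D)`. -/
def CheckOmega (k : ℕ) {p : E} (h : HolFun p) : Type _ := Omega k p ⧸ hLogForms k h

instance {p : E} (h : HolFun p) : AddCommGroup (KahlerD h) :=
  inferInstanceAs (AddCommGroup (Omega 1 p ⧸ kahlerRel h))

instance {p : E} (h : HolFun p) : Module (HolFun p) (KahlerD h) :=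
  inferInstanceAs (Module (HolFun p) (Omega 1 p ⧸ kahlerRel h))

instance (k : ℕ) {p : E} (h : HolFun p) : AddCommGroup (CheckOmega k h) :=
  inferInstanceAs (AddCommGroup (Omega k p ⧸ hLogForms k h))

instance (k : ℕ) {p : E} (h : HolFun p) : Module (HolFun p) (CheckOmega k h) :=
  inferInstanceAs (Module (HolFun p) (Omega k p ⧸ hLogForms k h))

/-- The quotient map `Ω^1_{V,p} → Ω^1_{D,p}`. -/
def KahlerD.mk {p : E} (h : HolFun p) : Omega 1 p →ₗ[HolFun p] KahlerD h :=
  (kahlerRel h).mkQ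

/-- The quotient map `Ω^k_{V,p} → Ω̌^k_{D,p}`. -/
def CheckOmega.mk (k : ℕ) {p : E} (h : HolFun p) : Omega k p →ₗ[HolFun p] CheckOmega k h :=
  (hLogForms k h).mkQ

theorem kahlerD_isTorsion {p : E} (h : HolFun p) :
    Module.IsTorsionBySet (HolFun p) (KahlerD h) (Ideal.span {h} : Ideal (HolFun p)) := by
  intro x a
  obtain ⟨η, rfl⟩ := Submodule.mkQ_surjective (kahlerRel h) x
  exact (Submodule.Quotient.mk_eq_zero (kahlerRel h)).2
    (Submodule.mem_sup_left (Submodule.smul_mem_smul a.2 trivial))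

theorem smul_mem_hLogForms (k : ℕ) {p : E} (h : HolFun p) (η : Omega k p) :
    h • η ∈ hLogForms k h := by
  obtain ⟨_, f, hf, rfl⟩ := h
  obtain ⟨_, α, hα, rfl⟩ := η
  exact ⟨f, α, f • α, rfl, rfl, isLogForm_of_analyticAt hf hα,
    Filter.Eventually.of_forall fun y _ => rfl⟩

theorem checkOmega_isTorsion (k : ℕ) {p : E} (h : HolFun p) :
    Module.IsTorsionBySet (HolFun p) (CheckOmega k h) (Ideal.span {h} : Ideal (HolFun p)) := by
  rintro x ⟨a, ha⟩
  obtain ⟨η, rfl⟩ := Submodule.mkQ_surjective (hLogForms k h) x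
  obtain ⟨b, rfl⟩ := Ideal.mem_span_singleton'.1 ha
  refine (Submodule.Quotient.mk_eq_zero (hLogForms k h)).2 ?_
  change (b * h) • η ∈ _
  rw [mul_smul]
  exact Submodule.smul_mem _ b (smul_mem_hLogForms k h η)

/-- `Ω^1_D` is an `𝒪_D`-module. -/
instance {p : E} (h : HolFun p) : Module (FunD h) (KahlerD h) :=
  (kahlerD_isTorsion h).module

instance {p : E} (h : HolFun p) : IsScalarTower (HolFun p) (FunD h) (KahlerD h) :=
  Module.IsTorsionBySet.isScalarTower (kahlerD_isTorsion h)

/-- `Ω̌^k_D` is an `𝒪_D`-module. -/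
instance (k : ℕ) {p : E} (h : HolFun p) : Module (FunD h) (CheckOmega k h) :=
  (checkOmega_isTorsion k h).module

instance (k : ℕ) {p : E} (h : HolFun p) :
    IsScalarTower (HolFun p) (FunD h) (CheckOmega k h) :=
  Module.IsTorsionBySet.isScalarTower (checkOmega_isTorsion k h)

/-- `θ_{D,p} = Hom_{𝒪_D}(Ω^1_D, 𝒪_D)`. -/
abbrev ThetaD {p : E} (h : HolFun p) : Type _ := Module.Dual (FunD h) (KahlerD h)

/-- The restriction to `D` of a logarithmic vector field `χ`: the element `[η] ↦ [η(χ)]`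
of `θ_{D,p}`. -/
def restrictToD {p : E} (h : HolFun p) (χ : derLog (Ideal.span {h})) : ThetaD h :=
  LinearMap.extendScalarsOfSurjective
    (show Function.Surjective (algebraMap (HolFun p) (FunD h)) from Ideal.Quotient.mk_surjective)
    (show KahlerD h →ₗ[HolFun p] FunD h from
      (kahlerRel h).liftQ ((Ideal.span {h}).mkQ ∘ₗ (evalForm p).flip χ.1) (by
        refine sup_le (Submodule.smul_le.2 fun r hr η _ => ?_)
          (Submodule.span_le.2 (Set.singleton_subset_iff.2 ?_))
        · refine (Submodule.Quotient.mk_eq_zero _).2 ?_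
          rw [map_smul]
          exact Ideal.mul_mem_right _ _ hr
        · exact (Submodule.Quotient.mk_eq_zero _).2 (χ.2 h (Ideal.mem_span_singleton_self h))))

/-! ### Free divisors in a complex manifold -/

section Manifold

variable {V : Type*} [TopologicalSpace V]

/-- The trace of `D ⊆ V` in a chart `φ`, a subset of the model space near each point `φ x`. -/
def inChart (φ : OpenPartialHomeomorph V E) (D : Set V) : Set E := φ.target ∩ φ.symm ⁻¹' D

/-- `D` is a free divisor in the complex manifold `V`: it is a hypersurface, i.e. at every point
it has (in holomorphic charts) a reduced equation, and `Der(log D)` is locally free, i.e. all its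
stalks are free modules. -/
def IsFreeDivisor (E : Type*) [NormedAddCommGroup E] [NormedSpace ℂ E] [ChartedSpace E V]
    (D : Set V) : Prop :=
  ∀ φ ∈ IsManifold.maximalAtlas 𝓘(ℂ, E) ω V, ∀ x ∈ φ.source,
    (∃ h : HolFun (φ x), IsReducedEquation (inChart φ D) h) ∧
      Module.Free (HolFun (φ x)) (derLog (vanishingIdeal (inChart φ D) (φ x)))

end Manifold

end FreeDivisor

end

noncomputable section

namespace FreeDivisor

variable {E : Type*} [NormedAddCommGroup E] [NormedSpace ℂ E]

/-! ### Divisibility of functions along their zero sets -/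

/-! The heart of the matter is `mem_hLogForms_iff`: a holomorphic form η lies in h Ω¹(log D) iff
η(χ) ∈ (h) for all logarithmic χ. With η = hτ one has h dτ = dη − (dh ∧ η)/h, so τ is logarithmic
exactly when h divides dh ∧ η. If it does, contracting with χ and a vector v, where dh(χ) ∈ (h),
shows that h divides η(χ) dh(v) for every v. Comparing vanishing orders along lines then forces η(χ)
to vanish on D, and reducedness puts it in (h). Conversely, the fields dh(v) w − dh(w) v annihilate
h, and η takes the value (dh ∧ η)(v, w) on them.

Since Ω¹_V is free on the coordinate forms, a functional Ω¹_V → 𝒪_D is evaluation at a vector field,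
which is logarithmic iff the functional kills dh. Hence θ_D consists of restrictions of logarithmic
fields (`restrictToD_surjective`), and h Ω¹(log D) is precisely the kernel of Ω¹_V → Hom(θ_D, 𝒪_D),
so the pairing exists and is injective on the left. The same description of functionals, with dh ∈ h
Ω¹(log D), gives bijectivity on the right.

Freeness enters only in `pairing_surjective`: a functional on θ_D lifts to Ψ : Der(log D) → 𝒪_V, and
χ ↦ Ψ(hχ)/h extends Ψ to all vector fields, so it is given by a holomorphic form. The biduality
isomorphism is the left map of the pairing. -/

/-- If `a g'` is divisible by `g` at a zero of `g ≢ 0`, then `a` vanishes there. -/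
theorem eq_zero_of_mul_deriv_eq {g a b : ℂ → ℂ} {z : ℂ} (hg : AnalyticAt ℂ g z)
    (ha : AnalyticAt ℂ a z) (hb : AnalyticAt ℂ b z) (hgz : g z = 0)
    (hne : ¬ ∀ᶠ t in 𝓝 z, g t = 0)
    (H : ∀ᶠ t in 𝓝 z, g t ≠ 0 → a t * deriv g t = g t * b t) : a z = 0 := by
  have hg0 : ∀ᶠ t in 𝓝[≠] z, g t ≠ 0 :=
    hg.eventually_eq_zero_or_eventually_ne_zero.resolve_left hne
  have heq : a * deriv g =ᶠ[𝓝 z] g * b := by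
    refine ((ha.mul hg.deriv).frequently_eq_iff_eventually_eq (hg.mul hb)).1 ?_
    refine Filter.Eventually.frequently ?_
    filter_upwards [hg0, H.filter_mono nhdsWithin_le_nhds] with t h1 h2 using h2 h1
  -- Differentiation lowers the order of the zero of `g` by exactly one. If `a z ≠ 0`, the left side
  -- therefore has smaller order than `g`, while `g * b` has at least the order of `g`.
  have ho := analyticOrderAt_congr heq
  rw [analyticOrderAt_mul ha hg.deriv, analyticOrderAt_mul hg hb] at ho
  have h1 := hg.analyticOrderAt_deriv_add_one
  simp only [hgz, sub_zero] at h1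
  by_contra haz
  rw [ha.analyticOrderAt_eq_zero.2 haz, zero_add] at ho
  have htop : analyticOrderAt g z ≠ ⊤ := fun h => hne (analyticOrderAt_eq_top.1 h)
  have hle : analyticOrderAt g z ≤ analyticOrderAt (deriv g) z := ho ▸ le_self_add
  have hfin : analyticOrderAt (deriv g) z ≠ ⊤ := by
    intro h
    rw [h, top_add] at h1
    exact htop h1.symm
  rw [← h1] at hle
  exact (ENat.add_one_le_iff hfin).1 hle |>.false

/-- An analytic function whose germ at `p` is nonzero vanishes identically near no point
close to `p`; more precisely it does not vanish identically on a line through such a point. -/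
theorem exists_line_not_eventually_zero {f : E → ℂ} {p : E} (hf : AnalyticAt ℂ f p)
    (hne : ¬ ∀ᶠ y in 𝓝 p, f y = 0) :
    ∀ᶠ q in 𝓝 p, ∃ v : E, ¬ ∀ᶠ t in 𝓝 (0 : ℂ), f (q + t • v) = 0 := by
  obtain ⟨r, hr, hball⟩ := Metric.eventually_nhds_iff_ball.1 hf.eventually_analyticAt
  filter_upwards [Metric.ball_mem_nhds p hr] with q hq
  obtain ⟨y, hy, hfy⟩ : ∃ y ∈ Metric.ball p r, f y ≠ 0 := by
    by_contra! hcon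
    exact hne (Filter.eventually_of_mem (Metric.ball_mem_nhds p hr) hcon)
  refine ⟨y - q, fun hev => hfy ?_⟩
  set L : ℂ → E := fun t => q + t • (y - q) with hL
  have hLan : ∀ t, AnalyticAt ℂ L t := fun t =>
    analyticAt_const.add (analyticAt_id.smul analyticAt_const)
  set U : Set ℂ := L ⁻¹' Metric.ball p r with hU
  -- The preimage of a ball under an affine map is convex, hence connected, so the identity theorem
  -- carries vanishing near `t = 0` (the point `q`) to `t = 1` (the point `y`).
  have hconv : Convex ℝ U := by
    intro s hs t ht a b ha hb hab
    obtain rfl : a = 1 - b := by linarith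
    have : L ((1 - b) • s + b • t) = (1 - b) • L s + b • L t := by
      simp only [hL, Complex.real_smul, ← Complex.coe_smul (E := E)]
      push_cast
      module
    rw [hU, Set.mem_preimage, this]
    exact convex_ball p r hs ht ha hb hab
  have han : AnalyticOnNhd ℂ (f ∘ L) U := fun t ht =>
    (hball (L t) ht).comp (hLan t)
  have h0 : (0 : ℂ) ∈ U := by simpa [hU, hL] using hq
  have h1 : (1 : ℂ) ∈ U := by simpa [hU, hL] using hy
  have := han.eqOn_zero_of_preconnected_of_eventuallyEq_zero hconv.isPreconnected h0 hev h1
  simpa [hL] using this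

/-- If `a df` is divisible by `f`, then `a` vanishes on the zero set of `f`. -/
theorem eventually_eq_zero_of_mul_fderiv [FiniteDimensional ℂ E] {f a : E → ℂ} {p : E}
    (hf : AnalyticAt ℂ f p) (ha : AnalyticAt ℂ a p) (hne : ¬ ∀ᶠ y in 𝓝 p, f y = 0)
    (H : ∀ v : E, ∃ b : E → ℂ, AnalyticAt ℂ b p ∧
      ∀ᶠ y in 𝓝 p, f y ≠ 0 → a y * fderiv ℂ f y v = f y * b y) :
    ∀ᶠ y in 𝓝 p, f y = 0 → a y = 0 := by
  let e := Module.finBasis ℂ E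
  -- Only the finitely many basis directions are used, so that all divisibility relations hold on a
  -- common neighbourhood; the quotient in the direction of the line is a combination of these.
  choose b hb hab using fun i => H (e i)
  have hab' := (Filter.eventually_all.2 hab).eventually_nhds
  filter_upwards [exists_line_not_eventually_zero hf hne, hf.eventually_analyticAt,
    ha.eventually_analyticAt, Filter.eventually_all.2 fun i => (hb i).eventually_analyticAt,
    hab', hf.eventually_analyticAt.eventually_nhds] with q ⟨v, hv⟩ hfq haq hbq Hq hfq' hq0
  have hL : AnalyticAt ℂ (fun t : ℂ => q + t • v) 0 :=
    analyticAt_const.add (analyticAt_id.smul analyticAt_const)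
  have hL0 : q + (0 : ℂ) • v = q := by simp
  have hLt : Filter.Tendsto (fun t : ℂ => q + t • v) (𝓝 0) (𝓝 q) := by
    simpa [hL0] using hL.continuousAt.tendsto
  have key := eq_zero_of_mul_deriv_eq (z := 0) (g := fun t => f (q + t • v))
    (a := fun t => a (q + t • v)) (b := fun t => ∑ i, e.repr v i * b i (q + t • v))
    (AnalyticAt.fun_comp (by rwa [hL0]) hL) (AnalyticAt.fun_comp (by rwa [hL0]) hL)
    (Finset.analyticAt_fun_sum _ fun i _ => analyticAt_const.mul
      (AnalyticAt.fun_comp (f := fun t : ℂ => q + t • v) (by rw [hL0]; exact hbq i) hL))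
    (by simpa using hq0) hv ?_
  · simpa using key
  · filter_upwards [hLt.eventually Hq, hLt.eventually hfq'] with t ht hft hne
    have hd : HasDerivAt (fun t : ℂ => q + t • v) v t := by
      simpa using ((hasDerivAt_id t).smul_const v).const_add q
    have hderiv : deriv (fun t : ℂ => f (q + t • v)) t = fderiv ℂ f (q + t • v) v :=
      (hft.differentiableAt.hasFDerivAt.comp_hasDerivAt t hd).deriv
    rw [hderiv]
    conv_lhs => rw [← e.sum_repr v]
    rw [map_sum, Finset.mul_sum, Finset.mul_sum]
    simp only [map_smul, smul_eq_mul, e.sum_repr]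
    exact Finset.sum_congr rfl fun i _ => by
      rw [mul_left_comm, ht i hne, mul_left_comm]

/-! ### Exterior products with the differential of a function -/

theorem analyticAt_clm {F G : Type*} [NormedAddCommGroup F] [NormedSpace ℂ F]
    [NormedAddCommGroup G] [NormedSpace ℂ G] (T : F →L[ℂ] G) {p : E} {f : E → F}
    (hf : AnalyticAt ℂ f p) : AnalyticAt ℂ (fun y => T (f y)) p :=
  (T.analyticAt (f p)).fun_comp hf

/-- The wedge product `df ∧ α` of the differential of a function with a form. -/
def dWedge {k : ℕ} (f : E → ℂ) (α : E → E [⋀^Fin k]→L[ℂ] ℂ) (y : E) :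
    E [⋀^Fin (k + 1)]→L[ℂ] ℂ :=
  ContinuousAlternatingMap.alternatizeUncurryFinCLM ℂ E ℂ ((fderiv ℂ f y).smulRight (α y))

theorem extDeriv_analyticAt {k : ℕ} {α : E → E [⋀^Fin k]→L[ℂ] ℂ} {p : E}
    (hα : AnalyticAt ℂ α p) : AnalyticAt ℂ (extDeriv α) p :=
  analyticAt_clm (ContinuousAlternatingMap.alternatizeUncurryFinCLM ℂ E ℂ) hα.fderiv

theorem extDeriv_smul_fun {k : ℕ} {f : E → ℂ} {α : E → E [⋀^Fin k]→L[ℂ] ℂ} {y : E}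
    (hf : DifferentiableAt ℂ f y) (hα : DifferentiableAt ℂ α y) :
    extDeriv (fun z => f z • α z) y = f y • extDeriv α y + dWedge f α y := by
  rw [extDeriv, fderiv_fun_smul hf hα, ContinuousAlternatingMap.alternatizeUncurryFin_add,
    ContinuousAlternatingMap.alternatizeUncurryFin_smul]
  rfl

theorem dWedge_one_apply (f : E → ℂ) (α : E → E [⋀^Fin 1]→L[ℂ] ℂ) (y v w : E) :
    dWedge f α y ![v, w] =
      fderiv ℂ f y v * α y (fun _ => w) - fderiv ℂ f y w * α y (fun _ => v) := by
  have h := ContinuousAlternatingMap.alternatizeUncurryFin_apply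
    ((fderiv ℂ f y).smulRight (α y)) ![v, w]
  rw [Fin.sum_univ_two] at h
  have e0 : Fin.removeNth 0 ![v, w] = fun _ : Fin 1 => w := by
    ext i; fin_cases i; rfl
  have e1 : Fin.removeNth 1 ![v, w] = fun _ : Fin 1 => v := by
    ext i; fin_cases i; rfl
  rw [e0, e1] at h
  refine h.trans ?_
  simp [sub_eq_add_neg]

theorem dWedge_smul {k : ℕ} (f : E → ℂ) (α : E → E [⋀^Fin k]→L[ℂ] ℂ) (u : ℂ)
    (τ : E → E [⋀^Fin k]→L[ℂ] ℂ) (y : E) (h : u • τ y = α y) :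
    u • dWedge f τ y = dWedge f α y := by
  rw [dWedge, dWedge, ← map_smul, ← h]
  congr 1
  ext v
  simp [mul_left_comm]

/-- An analytic map into alternating forms is divisible by `f` if all its values are. -/
theorem exists_eq_smul_of_apply [FiniteDimensional ℂ E] {k : ℕ} {f : E → ℂ} {p : E}
    {G : E → E [⋀^Fin k]→L[ℂ] ℂ}
    (H : ∀ m : Fin k → E, ∃ c : E → ℂ, AnalyticAt ℂ c p ∧ ∀ᶠ y in 𝓝 p, G y m = f y * c y) :
    ∃ γ : E → E [⋀^Fin k]→L[ℂ] ℂ, AnalyticAt ℂ γ p ∧ ∀ᶠ y in 𝓝 p, G y = f y • γ y := by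
  let e := Module.finBasis ℂ E
  -- A form is determined by its values on tuples of basis vectors, so `ev` is injective. A linear
  -- left inverse reassembles the quotients of these values into an analytic form, with no basis of
  -- alternating forms needed.
  let ev : (E [⋀^Fin k]→L[ℂ] ℂ) →ₗ[ℂ] ((Fin k → Fin (Module.finrank ℂ E)) → ℂ) :=
    { toFun := fun a s => a fun i => e (s i)
      map_add' := fun _ _ => rfl
      map_smul' := fun _ _ => rfl }
  have hev : LinearMap.ker ev = ⊥ := by
    refine LinearMap.ker_eq_bot.2 fun a b h => ?_
    refine ContinuousAlternatingMap.toAlternatingMap_injective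
      (AlternatingMap.coe_multilinearMap_injective
        (Module.Basis.ext_multilinear (fun _ => e) fun v => congrFun h v))
  obtain ⟨L, hL⟩ := ev.exists_leftInverse_of_injective hev
  choose c hc hcG using fun s : Fin k → Fin (Module.finrank ℂ E) => H fun i => e (s i)
  refine ⟨fun y => L.toContinuousLinearMap fun s => c s y,
    (L.toContinuousLinearMap.analyticAt _).comp (AnalyticAt.pi fun s => hc s), ?_⟩
  filter_upwards [Filter.eventually_all.2 hcG] with y hy
  have h1 : ev (G y) = f y • fun s => c s y := funext fun s => hy s
  calc G y = (L ∘ₗ ev) (G y) := by rw [hL]; rfl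
    _ = L (f y • fun s => c s y) := by rw [← h1]; rfl
    _ = _ := map_smul L _ _

theorem analyticAt_apply_two {γ : E → E [⋀^Fin 2]→L[ℂ] ℂ} {w : E → E} {p : E}
    (hγ : AnalyticAt ℂ γ p) (hw : AnalyticAt ℂ w p) (v : E) :
    AnalyticAt ℂ (fun y => γ y ![w y, v]) p := by
  let T : (E [⋀^Fin 2]→L[ℂ] ℂ) →L[ℂ] E →L[ℂ] E [⋀^Fin 1]→L[ℂ] ℂ :=
    (ContinuousAlternatingMap.curryLeftLI (𝕜 := ℂ) (E := E) (F := ℂ) (n := 1)).toContinuousLinearMap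
  have h0 : AnalyticAt ℂ (fun y => T (γ y)) p := 
    analyticAt_clm (G := E →L[ℂ] E [⋀^Fin 1]→L[ℂ] ℂ) T hγ
  have h1 : AnalyticAt ℂ (fun y => T (γ y) (w y)) p :=
    analyticAt_bilin (ContinuousLinearMap.id ℂ (E →L[ℂ] E [⋀^Fin 1]→L[ℂ] ℂ)) h0 hw
  exact analyticAt_clm (ContinuousAlternatingMap.apply ℂ E ℂ ![v]) h1

/-! ### Germs -/

variable {p : E}

/-- The germ of an analytic function. -/
def HolFun.of {f : E → ℂ} (hf : AnalyticAt ℂ f p) : HolFun p := ⟨f, f, hf, rfl⟩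

/-- The germ of an analytic map. -/
def HolGerm.of {F : Type*} [NormedAddCommGroup F] [NormedSpace ℂ F] {f : E → F}
    (hf : AnalyticAt ℂ f p) : HolGerm F p := ⟨f, f, hf, rfl⟩

theorem HolFun.exists_of (g : HolFun p) :
    ∃ (f : E → ℂ) (hf : AnalyticAt ℂ f p), g = HolFun.of hf := by
  obtain ⟨_, f, hf, rfl⟩ := g
  exact ⟨f, hf, rfl⟩

theorem HolGerm.exists_of {F : Type*} [NormedAddCommGroup F] [NormedSpace ℂ F]
    (g : HolGerm F p) : ∃ (f : E → F) (hf : AnalyticAt ℂ f p), g = HolGerm.of hf := by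
  obtain ⟨_, f, hf, rfl⟩ := g
  exact ⟨f, hf, rfl⟩

theorem HolFun.of_eq_of {f g : E → ℂ} (hf : AnalyticAt ℂ f p) (hg : AnalyticAt ℂ g p) :
    HolFun.of hf = HolFun.of hg ↔ f =ᶠ[𝓝 p] g :=
  Subtype.ext_iff.trans Filter.Germ.coe_eq

theorem evalForm_of {α : E → E [⋀^Fin 1]→L[ℂ] ℂ} {w : E → E} (hα : AnalyticAt ℂ α p)
    (hw : AnalyticAt ℂ w p) (h : AnalyticAt ℂ (fun y => α y fun _ => w y) p) :
    evalForm p (HolGerm.of hα) (HolGerm.of hw) = HolFun.of h := rfl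

theorem analyticAt_eval {α : E → E [⋀^Fin 1]→L[ℂ] ℂ} {w : E → E} (hα : AnalyticAt ℂ α p)
    (hw : AnalyticAt ℂ w p) : AnalyticAt ℂ (fun y => α y fun _ => w y) p := by
  -- Analyticity is already contained in the fact that `evalForm` takes values in `HolFun p`.
  obtain ⟨f, hf, e⟩ := HolFun.exists_of (evalForm p (HolGerm.of hα) (HolGerm.of hw))
  exact hf.congr (Filter.Germ.coe_eq.1 (Subtype.ext_iff.1 e)).symm

theorem analyticAt_fderiv_apply {f : E → ℂ} {w : E → E} (hf : AnalyticAt ℂ f p)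
    (hw : AnalyticAt ℂ w p) : AnalyticAt ℂ (fun y => fderiv ℂ f y (w y)) p :=
  analyticAt_bilin (ContinuousLinearMap.id ℂ (E →L[ℂ] ℂ)) hf.fderiv hw

theorem evalForm_d_of {f : E → ℂ} {w : E → E} (hf : AnalyticAt ℂ f p)
    (hw : AnalyticAt ℂ w p) :
    evalForm p (d (HolFun.of hf)) (HolGerm.of hw) =
      HolFun.of (analyticAt_fderiv_apply hf hw) := rfl

theorem of_mem_span_iff {f g : E → ℂ} (hf : AnalyticAt ℂ f p) (hg : AnalyticAt ℂ g p) :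
    HolFun.of hg ∈ Ideal.span {HolFun.of hf} ↔
      ∃ c : E → ℂ, AnalyticAt ℂ c p ∧ ∀ᶠ y in 𝓝 p, g y = f y * c y := by
  rw [Ideal.mem_span_singleton]
  constructor
  · rintro ⟨c, hc⟩
    obtain ⟨c, hc', rfl⟩ := HolFun.exists_of c
    exact ⟨c, hc', Filter.Germ.coe_eq.1 (Subtype.ext_iff.1 hc)⟩
  · rintro ⟨c, hc, e⟩
    exact ⟨HolFun.of hc, Subtype.ext (Filter.Germ.coe_eq.2 e)⟩

/-- The Leibniz rule. -/
theorem evalForm_d_mul (u g : HolFun p) (χ : Theta p) :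
    evalForm p (d (u * g)) χ = u * evalForm p (d g) χ + g * evalForm p (d u) χ := by
  obtain ⟨u, hu, rfl⟩ := HolFun.exists_of u
  obtain ⟨g, hg, rfl⟩ := HolFun.exists_of g
  obtain ⟨w, hw, rfl⟩ := χ.exists_of
  refine (HolFun.of_eq_of (analyticAt_fderiv_apply (hu.mul hg) hw)
    ((hu.mul (analyticAt_fderiv_apply hg hw)).add (hg.mul (analyticAt_fderiv_apply hu hw)))).2 ?_
  filter_upwards [hu.eventually_analyticAt, hg.eventually_analyticAt] with y h1 h2
  rw [fderiv_mul h1.differentiableAt h2.differentiableAt]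
  simp

/-- A vector field is logarithmic along `{h = 0}` if `h` divides `dh(χ)`. -/
theorem mem_derLog_iff {h : HolFun p} {χ : Theta p} :
    χ ∈ derLog (Ideal.span {h}) ↔ evalForm p (d h) χ ∈ Ideal.span {h} := by
  refine ⟨fun H => H h (Ideal.mem_span_singleton_self h), fun H f hf => ?_⟩
  obtain ⟨u, rfl⟩ := Ideal.mem_span_singleton'.1 hf
  rw [evalForm_d_mul]
  exact add_mem (Ideal.mul_mem_left _ _ H)
    (Ideal.mul_mem_right _ _ (Ideal.mem_span_singleton_self h))

/-- Regularity of h dτ makes dh ∧ η divisible by h; contracting with χ leaves η(χ) dh(v) divisible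
by h for every v, which forces η(χ) to vanish on the divisor. -/
theorem evalForm_mem_span_of_mem_hLogForms [FiniteDimensional ℂ E] {S : Set E} {h : HolFun p}
    (hh : IsReducedEquation S h) {η : Omega 1 p} (hη : η ∈ hLogForms 1 h) {χ : Theta p}
    (hχ : χ ∈ derLog (Ideal.span {h})) : evalForm p η χ ∈ Ideal.span {h} := by
  obtain ⟨f, hf, rfl⟩ := HolFun.exists_of h
  obtain ⟨α, hα, rfl⟩ := η.exists_of
  obtain ⟨w, hw, rfl⟩ := χ.exists_of
  obtain ⟨f', τ, α', hf', hα', hτ, e⟩ := hη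
  replace hf' : f' =ᶠ[𝓝 p] f := Filter.Germ.coe_eq.1 hf'
  replace hα' : α' =ᶠ[𝓝 p] α := Filter.Germ.coe_eq.1 hα'
  obtain ⟨hd, -, β, hβ, eβ⟩ := isLogForm_congr hf' hτ
  have e' : ∀ᶠ y in 𝓝 p, f y ≠ 0 → f y • τ y = α y := by
    filter_upwards [e, hf', hα'] with y h1 h2 h3
    rwa [h2, h3] at h1
  rw [mem_derLog_iff, evalForm_d_of, of_mem_span_iff] at hχ
  obtain ⟨c, hc, ec⟩ := hχ
  have hne : ¬ ∀ᶠ y in 𝓝 p, f y = 0 := fun H =>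
    hh.ne_zero (Subtype.ext (Filter.Germ.coe_eq.2 H))
  -- Reducedness replaces divisibility by `f` with vanishing on `S`.
  rw [evalForm_of hα hw (analyticAt_eval hα hw), ← hh.generates]
  obtain ⟨f₁, hf₁, hS⟩ := hh.zeroSet
  replace hf₁ : f₁ =ᶠ[𝓝 p] f := Filter.Germ.coe_eq.1 hf₁
  refine ⟨_, rfl, ?_⟩
  -- The quotient comes from evaluating df ∧ α = f (dα − β) on (w, v) and substituting df(w) = f c.
  have key := eventually_eq_zero_of_mul_fderiv hf (analyticAt_eval hα hw) hne fun v =>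
    ⟨fun y => c y * α y (fun _ => v) - (extDeriv α y - β y) ![w y, v],
      (hc.mul (analyticAt_eval hα analyticAt_const)).sub
        (analyticAt_apply_two ((extDeriv_analyticAt hα).sub hβ) hw v), ?_⟩
  · filter_upwards [key, hS, hf₁] with y h1 h2 h3 hy
    exact h1 (h3 ▸ h2.1 hy)
  · filter_upwards [hd, eβ, e', e'.eventually_nhds, ec,
      hf.eventually_analyticAt] with y hdy hβy hαy hev hcy hfy hy
    have hnear : α =ᶠ[𝓝 y] fun z => f z • τ z := by
      filter_upwards [hev, hfy.continuousAt.eventually_ne hy] with z h1 h2 using (h1 h2).symm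
    have hdα : extDeriv α y = f y • extDeriv τ y + dWedge f τ y := by
      rw [hnear.extDeriv_eq, extDeriv_smul_fun hfy.differentiableAt (hdy hy)]
    -- From α = f τ one gets dα = β + df ∧ τ; multiplying by f turns f df ∧ τ into df ∧ α.
    have hW : dWedge f α y = f y • (extDeriv α y - β y) := by
      rw [← dWedge_smul f α (f y) τ y (hαy hy), hdα, hβy hy, add_sub_cancel_left]
    have h2 := congrArg (fun a => a ![w y, v]) hW
    simp only [dWedge_one_apply, ContinuousAlternatingMap.smul_apply, smul_eq_mul, hcy] at h2
    linear_combination -h2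

/-- Testing η on fields tangent to all level sets of h recovers every value of dh ∧ η, so h divides
dh ∧ η, and η/h is logarithmic. Neither reducedness nor freeness plays a role in this direction. -/
theorem mem_hLogForms_of_evalForm_mem_span [FiniteDimensional ℂ E] {h : HolFun p}
    {η : Omega 1 p}
    (H : ∀ χ ∈ derLog (Ideal.span {h}), evalForm p η χ ∈ Ideal.span {h}) :
    η ∈ hLogForms 1 h := by
  obtain ⟨f, hf, rfl⟩ := HolFun.exists_of h
  obtain ⟨α, hα, rfl⟩ := η.exists_of
  obtain ⟨γ, hγ, eγ⟩ : ∃ γ : E → E [⋀^Fin 2]→L[ℂ] ℂ, AnalyticAt ℂ γ p ∧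
      ∀ᶠ y in 𝓝 p, dWedge f α y = f y • γ y := by
    refine exists_eq_smul_of_apply fun m => ?_
    -- This field is annihilated by df, hence logarithmic, and α takes the value (df ∧ α)(m 0, m 1)
    -- on it.
    have hw : AnalyticAt ℂ
        (fun y => fderiv ℂ f y (m 0) • m 1 - fderiv ℂ f y (m 1) • m 0) p :=
      ((analyticAt_fderiv_apply hf analyticAt_const).smul analyticAt_const).sub
        ((analyticAt_fderiv_apply hf analyticAt_const).smul analyticAt_const)
    have h1 := H (HolGerm.of hw) (mem_derLog_iff.2 ?_)
    · rw [evalForm_of hα hw (analyticAt_eval hα hw), of_mem_span_iff] at h1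
      obtain ⟨c, hc, ec⟩ := h1
      refine ⟨c, hc, ?_⟩
      filter_upwards [ec] with y hy
      rw [← hy]
      have hm : m = ![m 0, m 1] := by ext i; fin_cases i <;> rfl
      conv_lhs => rw [hm, dWedge_one_apply]
      let ℓ := (ContinuousAlternatingMap.ofSubsingleton ℂ E ℂ (0 : Fin 1)).symm (α y)
      change fderiv ℂ f y (m 0) * ℓ (m 1) - fderiv ℂ f y (m 1) * ℓ (m 0) = ℓ _
      simp
    · rw [evalForm_d_of, of_mem_span_iff]
      refine ⟨0, analyticAt_const, Filter.Eventually.of_forall fun y => ?_⟩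
      simp [mul_comm]
  have hev : ∀ᶠ y in 𝓝 p, f y ≠ 0 → f y • (f y)⁻¹ • α y = α y :=
    Filter.Eventually.of_forall fun y hy => smul_inv_smul₀ hy _
  have hdiff : ∀ᶠ y in 𝓝 p, f y ≠ 0 →
      DifferentiableAt ℂ (fun y => (f y)⁻¹ • α y) y := by
    filter_upwards [hf.eventually_analyticAt, hα.eventually_analyticAt] with y h1 h2 hy
    exact (h1.differentiableAt.inv hy).smul h2.differentiableAt
  -- With τ = α/f the Leibniz rule gives f dτ = dα − df ∧ τ, and df ∧ τ = (df ∧ α)/f = γ off the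
  -- zero set.
  refine ⟨f, fun y => (f y)⁻¹ • α y, α, rfl, rfl, ⟨hdiff, ⟨α, hα, hev⟩,
    ⟨fun y => extDeriv α y - γ y, (extDeriv_analyticAt hα).sub hγ, ?_⟩⟩, hev⟩
  filter_upwards [hdiff, hf.eventually_analyticAt, eγ] with y hdy hfy hγy hy
  have hnear : α =ᶠ[𝓝 y] fun z => f z • (f z)⁻¹ • α z := by
    filter_upwards [hfy.continuousAt.eventually_ne hy] with z h2
      using (smul_inv_smul₀ h2 _).symm
  have hdα := hnear.extDeriv_eq
  rw [extDeriv_smul_fun hfy.differentiableAt (hdy hy)] at hdα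
  have hW : f y • dWedge f (fun z => (f z)⁻¹ • α z) y = f y • γ y := by
    rw [← hγy]
    exact dWedge_smul f α (f y) _ y (smul_inv_smul₀ hy _)
  have hW' : dWedge f (fun z => (f z)⁻¹ • α z) y = γ y := by
    rw [← inv_smul_smul₀ hy (γ y)]
    exact (inv_smul_smul₀ hy _).symm.trans (congrArg ((f y)⁻¹ • ·) hW)
  rw [hdα, hW', add_sub_cancel_right]

/-- `h Ω¹(log D)` consists of the forms whose values on logarithmic vector fields are divisible
by `h`. -/
theorem mem_hLogForms_iff [FiniteDimensional ℂ E] {S : Set E} {h : HolFun p}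
    (hh : IsReducedEquation S h) {η : Omega 1 p} :
    η ∈ hLogForms 1 h ↔
      ∀ χ ∈ derLog (Ideal.span {h}), evalForm p η χ ∈ Ideal.span {h} :=
  ⟨fun hη _ hχ => evalForm_mem_span_of_mem_hLogForms hh hη hχ,
    mem_hLogForms_of_evalForm_mem_span⟩

/-! ### Duality of vector fields and one-forms -/

/-- The constant vector field `v`. -/
def constField (p v : E) : Theta p := HolGerm.of (analyticAt_const (v := v))

/-- The constant one-form `ℓ`. -/
def constForm (p : E) (ℓ : E →L[ℂ] ℂ) : Omega 1 p :=
  HolGerm.of (analyticAt_const (v := ContinuousAlternatingMap.ofSubsingleton ℂ E ℂ (0 : Fin 1) ℓ))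

theorem HolGerm.sum_of_eq {F : Type*} [NormedAddCommGroup F] [NormedSpace ℂ F] {ι : Type*}
    (s : Finset ι) {f : ι → E → F} (hf : ∀ i, AnalyticAt ℂ (f i) p) :
    ∑ i ∈ s, HolGerm.of (hf i) = HolGerm.of (Finset.analyticAt_fun_sum s fun i _ => hf i) := by
  classical
  induction s using Finset.induction_on with
  | empty => rfl
  | insert a s ha ih =>
    rw [Finset.sum_insert ha, ih]
    refine Subtype.ext (Filter.Germ.coe_eq.2 (Filter.Eventually.of_forall fun y => ?_))
    exact (Finset.sum_insert (f := fun i => f i y) ha).symm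

/-- The coordinates of a basis as constant one-forms. -/
def coordForm [FiniteDimensional ℂ E] {ι : Type*} (e : Module.Basis ι ℂ E) (p : E) (i : ι) :
    Omega 1 p :=
  constForm p (LinearMap.toContinuousLinearMap (e.coord i))

theorem theta_eq_sum [FiniteDimensional ℂ E] {ι : Type*} [Fintype ι]
    (e : Module.Basis ι ℂ E) (χ : Theta p) :
    χ = ∑ i, evalForm p (coordForm e p i) χ • constField p (e i) := by
  obtain ⟨w, hw, rfl⟩ := HolGerm.exists_of χ
  have hc : ∀ i, AnalyticAt ℂ (fun y => e.coord i (w y)) p := fun i =>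
    analyticAt_clm (LinearMap.toContinuousLinearMap (e.coord i)) hw
  have := HolGerm.sum_of_eq Finset.univ fun i =>
    (hc i).fun_smul (analyticAt_const (v := e i) (x := p))
  refine Eq.trans ?_ this.symm
  refine Subtype.ext (Filter.Germ.coe_eq.2 (Filter.Eventually.of_forall fun y => ?_))
  exact (e.sum_repr (w y)).symm

theorem omega_eq_sum [FiniteDimensional ℂ E] {ι : Type*} [Fintype ι]
    (e : Module.Basis ι ℂ E) (η : Omega 1 p) :
    η = ∑ i, evalForm p η (constField p (e i)) • coordForm e p i := by
  obtain ⟨α, hα, rfl⟩ := HolGerm.exists_of η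
  have := HolGerm.sum_of_eq Finset.univ fun i =>
    (analyticAt_eval hα (analyticAt_const (v := e i))).fun_smul (analyticAt_const
      (v := ContinuousAlternatingMap.ofSubsingleton ℂ E ℂ (0 : Fin 1)
        (LinearMap.toContinuousLinearMap (e.coord i))) (x := p))
  refine Eq.trans ?_ this.symm
  refine Subtype.ext (Filter.Germ.coe_eq.2 (Filter.Eventually.of_forall fun y => ?_))
  ext m
  let ℓ := (ContinuousAlternatingMap.ofSubsingleton ℂ E ℂ (0 : Fin 1)).symm (α y)
  have hm : m = fun _ => m 0 := by ext i; rw [Subsingleton.elim i 0]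
  have h1 : α y m = ℓ (m 0) := by
    conv_lhs => rw [hm]
    rfl
  rw [h1, ContinuousAlternatingMap.sum_apply]
  conv_lhs => rw [← e.sum_repr (m 0), map_sum]
  refine Finset.sum_congr rfl fun i _ => ?_
  rw [map_smul, smul_eq_mul, mul_comm]
  rfl

/-- A linear functional on vector fields is given by a one-form. -/
theorem exists_form_of_functional [FiniteDimensional ℂ E] (Ψ : Theta p →ₗ[HolFun p] HolFun p) :
    ∃ η : Omega 1 p, ∀ χ, evalForm p η χ = Ψ χ := by
  let e := Module.finBasis ℂ E
  refine ⟨∑ i, Ψ (constField p (e i)) • coordForm e p i, fun χ => ?_⟩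
  conv_rhs => rw [theta_eq_sum e χ, map_sum]
  rw [map_sum, LinearMap.sum_apply]
  refine Finset.sum_congr rfl fun i _ => ?_
  rw [map_smul, LinearMap.smul_apply, map_smul, smul_eq_mul, smul_eq_mul, mul_comm]

/-- A linear functional on one-forms with values in a quotient of `𝒪_V` is evaluation at a
vector field. -/
theorem exists_field_of_functional [FiniteDimensional ℂ E] (J : Ideal (HolFun p))
    (Ψ : Omega 1 p →ₗ[HolFun p] HolFun p ⧸ J) :
    ∃ χ : Theta p, ∀ η, Ideal.Quotient.mk J (evalForm p η χ) = Ψ η := by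
  let e := Module.finBasis ℂ E
  -- Arbitrary lifts suffice, because the values of the field on forms matter only modulo `J`.
  choose a ha using fun i => Ideal.Quotient.mk_surjective (Ψ (coordForm e p i))
  refine ⟨∑ i, a i • constField p (e i), fun η => ?_⟩
  conv_rhs => rw [omega_eq_sum e η, map_sum]
  rw [map_sum, map_sum]
  refine Finset.sum_congr rfl fun i _ => ?_
  rw [map_smul, smul_eq_mul, mul_comm, map_smul, ← ha i]
  exact map_mul (Ideal.Quotient.mk J) _ _

/-! ### The pairing -/

/-- Through each point near `p` there is a line on which the first factor, if nonzero as a germ, has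
isolated zeros there; the second factor then vanishes at that point by the one-variable case. -/
theorem holFun_eq_zero_or_eq_zero {a b : HolFun p} (h : a * b = 0) : a = 0 ∨ b = 0 := by
  obtain ⟨f, hf, rfl⟩ := HolFun.exists_of a
  obtain ⟨g, hg, rfl⟩ := HolFun.exists_of b
  by_contra! hcon
  have hf0 : ¬ ∀ᶠ y in 𝓝 p, f y = 0 := fun H => hcon.1 (Subtype.ext (Filter.Germ.coe_eq.2 H))
  have hg0 : ¬ ∀ᶠ y in 𝓝 p, g y = 0 := fun H => hcon.2 (Subtype.ext (Filter.Germ.coe_eq.2 H))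
  have hfg : ∀ᶠ y in 𝓝 p, f y * g y = 0 := Filter.Germ.coe_eq.1 (Subtype.ext_iff.1 h)
  refine hg0 ?_
  filter_upwards [exists_line_not_eventually_zero hf hf0, hfg.eventually_nhds,
    hf.eventually_analyticAt, hg.eventually_analyticAt] with q ⟨v, hv⟩ hq hfq hgq
  have hL : AnalyticAt ℂ (fun t : ℂ => q + t • v) 0 :=
    analyticAt_const.add (analyticAt_id.smul analyticAt_const)
  have hL0 : q + (0 : ℂ) • v = q := by simp
  have hLt : Filter.Tendsto (fun t : ℂ => q + t • v) (𝓝 0) (𝓝 q) := by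
    simpa [hL0] using hL.continuousAt.tendsto
  have hfL : AnalyticAt ℂ (fun t : ℂ => f (q + t • v)) 0 :=
    AnalyticAt.fun_comp (by rwa [hL0]) hL
  have hgL : AnalyticAt ℂ (fun t : ℂ => g (q + t • v)) 0 :=
    AnalyticAt.fun_comp (by rwa [hL0]) hL
  have h1 := hfL.eventually_eq_zero_or_eventually_ne_zero.resolve_left hv
  rcases hgL.eventually_eq_zero_or_eventually_ne_zero with h2 | h2
  · simpa using h2.self_of_nhds
  · obtain ⟨t, ht1, ht2, ht3⟩ :=
      (h1.and (h2.and ((hLt.eventually hq).filter_mono nhdsWithin_le_nhds))).exists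
    exact absurd ht3 (mul_ne_zero ht1 ht2)

theorem mul_left_cancel_of_ne_zero {h a b : HolFun p} (hh : h ≠ 0) (H : h * a = h * b) :
    a = b := by
  refine sub_eq_zero.1 ((holFun_eq_zero_or_eq_zero (a := h) ?_).resolve_left hh)
  rw [mul_sub, H, sub_self]

theorem restrictToD_mk {h : HolFun p} (χ : derLog (Ideal.span {h})) (η : Omega 1 p) :
    restrictToD h χ (KahlerD.mk h η) = Ideal.Quotient.mk _ (evalForm p η χ.1) := rfl

theorem kahlerD_mk_surjective (h : HolFun p) : Function.Surjective (KahlerD.mk h) :=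
  Submodule.mkQ_surjective _

theorem checkOmega_mk_surjective (k : ℕ) (h : HolFun p) :
    Function.Surjective (CheckOmega.mk k h) :=
  Submodule.mkQ_surjective _

theorem thetaD_ext {h : HolFun p} {χ ψ : ThetaD h}
    (H : ∀ η, χ (KahlerD.mk h η) = ψ (KahlerD.mk h η)) : χ = ψ := by
  ext x
  obtain ⟨η, rfl⟩ := kahlerD_mk_surjective h x
  exact H η

/-- A linear map `Ω¹_V → 𝒪_D` killing `dh` is evaluation at a logarithmic vector field. -/
theorem exists_derLog_of_functional [FiniteDimensional ℂ E] {h : HolFun p}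
    (Ψ : Omega 1 p →ₗ[HolFun p] FunD h)
    (hΨ : Ψ (d h) = 0) :
    ∃ χ : derLog (Ideal.span {h}), ∀ η, restrictToD h χ (KahlerD.mk h η) = Ψ η := by
  obtain ⟨χ, hχ⟩ := exists_field_of_functional _ Ψ
  refine ⟨⟨χ, mem_derLog_iff.2 ?_⟩, hχ⟩
  rw [← Ideal.Quotient.eq_zero_iff_mem, hχ, hΨ]

theorem kahlerD_mk_d (h : HolFun p) : KahlerD.mk h (d h) = 0 :=
  (Submodule.Quotient.mk_eq_zero _).2
    (Submodule.mem_sup_right (Submodule.mem_span_singleton_self _))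

/-- Every element of `θ_D` is the restriction of a logarithmic vector field. -/
theorem restrictToD_surjective [FiniteDimensional ℂ E] (h : HolFun p) :
    Function.Surjective (restrictToD h) := by
  intro ψ
  obtain ⟨χ, hχ⟩ := exists_derLog_of_functional
    ((ψ.restrictScalars (HolFun p)) ∘ₗ KahlerD.mk h)
    (by rw [LinearMap.comp_apply, kahlerD_mk_d, map_zero])
  exact ⟨χ, thetaD_ext hχ⟩

theorem mem_hLogForms_iff_thetaD [FiniteDimensional ℂ E] {S : Set E} {h : HolFun p}
    (hh : IsReducedEquation S h)
    {η : Omega 1 p} : η ∈ hLogForms 1 h ↔ ∀ χ : ThetaD h, χ (KahlerD.mk h η) = 0 := by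
  rw [mem_hLogForms_iff hh]
  constructor
  · intro H χ
    obtain ⟨χ, rfl⟩ := restrictToD_surjective h χ
    rw [restrictToD_mk, Ideal.Quotient.eq_zero_iff_mem]
    exact H _ χ.2
  · intro H χ hχ
    rw [← Ideal.Quotient.eq_zero_iff_mem, ← restrictToD_mk ⟨χ, hχ⟩]
    exact H _

theorem algebraMap_funD_surjective (h : HolFun p) :
    Function.Surjective (algebraMap (HolFun p) (FunD h)) := Ideal.Quotient.mk_surjective

/-- The pairing `Ω̌¹_D × θ_D → 𝒪_D`. -/
def pairing [FiniteDimensional ℂ E] {S : Set E} {h : HolFun p} (hh : IsReducedEquation S h) :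
    CheckOmega 1 h →ₗ[FunD h] ThetaD h →ₗ[FunD h] FunD h :=
  LinearMap.extendScalarsOfSurjective (algebraMap_funD_surjective h)
    (show CheckOmega 1 h →ₗ[HolFun p] ThetaD h →ₗ[FunD h] FunD h from
      (hLogForms 1 h).liftQ
        (((Module.Dual.eval (FunD h) (KahlerD h)).restrictScalars (HolFun p)) ∘ₗ KahlerD.mk h)
        fun _ hη => LinearMap.ext fun χ => (mem_hLogForms_iff_thetaD hh).1 hη χ)

theorem pairing_mk [FiniteDimensional ℂ E] {S : Set E} {h : HolFun p}
    (hh : IsReducedEquation S h) (η : Omega 1 p)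
    (χ : ThetaD h) : pairing hh (CheckOmega.mk 1 h η) χ = χ (KahlerD.mk h η) := rfl

theorem pairing_injective [FiniteDimensional ℂ E] {S : Set E} {h : HolFun p}
    (hh : IsReducedEquation S h) :
    Function.Injective (pairing hh) := by
  refine (injective_iff_map_eq_zero _).2 fun x hx => ?_
  obtain ⟨η, rfl⟩ := checkOmega_mk_surjective 1 h x
  refine (Submodule.Quotient.mk_eq_zero _).2 ((mem_hLogForms_iff_thetaD hh).2 fun χ => ?_)
  rw [← pairing_mk hh, hx, LinearMap.zero_apply]

/-- Restriction of logarithmic vector fields as a linear map. -/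
def restrictLin (h : HolFun p) : derLog (Ideal.span {h}) →ₗ[HolFun p] ThetaD h where
  toFun := restrictToD h
  map_add' χ ψ := thetaD_ext fun η => by
    rw [LinearMap.add_apply]
    simp only [restrictToD_mk, Submodule.coe_add, map_add]
  map_smul' c χ := thetaD_ext fun η => by
    rw [LinearMap.smul_apply]
    simp only [restrictToD_mk, Submodule.coe_smul, map_smul, RingHom.id_apply]
    rfl

theorem smul_mem_derLog (h : HolFun p) (χ : Theta p) : h • χ ∈ derLog (Ideal.span {h}) := by
  rw [mem_derLog_iff, map_smul]
  exact Ideal.mul_mem_right _ _ (Ideal.mem_span_singleton_self h)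

/-- Projectivity of Der(log D) lifts a functional on θ_D to one with values in 𝒪_V; since h θ_V ⊆
Der(log D), the lift extends to all of θ_V after division by h, and θ_V is dual to Ω¹_V. -/
theorem pairing_surjective [FiniteDimensional ℂ E] {S : Set E} {h : HolFun p}
    (hh : IsReducedEquation S h)
    [Module.Projective (HolFun p) (derLog (Ideal.span {h}))] :
    Function.Surjective (pairing hh) := by
  intro ψ
  obtain ⟨Ψ, hΨ⟩ := Module.projective_lifting_property (Ideal.span {h}).mkQ
    ((ψ.restrictScalars (HolFun p)) ∘ₗ restrictLin h) (Submodule.mkQ_surjective _)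
  have hΨ' : ∀ χ, Ideal.Quotient.mk (Ideal.span {h}) (Ψ χ) = ψ (restrictToD h χ) :=
    fun χ => LinearMap.congr_fun hΨ χ
  -- The field hχ restricts to zero on D, so its image under the lift is a multiple of h. Cancelling
  -- h makes the quotient unique, hence linear in χ.
  have hdvd : ∀ χ : Theta p, ∃ c, Ψ ⟨h • χ, smul_mem_derLog h χ⟩ = h * c := by
    intro χ
    refine Ideal.mem_span_singleton.1 (Ideal.Quotient.eq_zero_iff_mem.1 ?_)
    rw [hΨ', show restrictToD h ⟨h • χ, smul_mem_derLog h χ⟩ = 0 from thetaD_ext fun η => ?_,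
      map_zero]
    rw [restrictToD_mk, map_smul, LinearMap.zero_apply, Ideal.Quotient.eq_zero_iff_mem]
    exact Ideal.mul_mem_right _ _ (Ideal.mem_span_singleton_self h)
  choose c hc using hdvd
  let C : Theta p →ₗ[HolFun p] HolFun p :=
    { toFun := c
      map_add' := fun χ χ' => by
        refine mul_left_cancel_of_ne_zero hh.ne_zero ?_
        rw [mul_add, ← hc, ← hc, ← hc, ← map_add]
        exact congrArg Ψ (Subtype.ext (smul_add _ _ _))
      map_smul' := fun a χ => by
        refine mul_left_cancel_of_ne_zero hh.ne_zero ?_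
        rw [RingHom.id_apply, smul_eq_mul, mul_left_comm, ← hc, ← hc, ← smul_eq_mul, ← map_smul]
        exact congrArg Ψ (Subtype.ext (smul_comm _ _ _)) }
  obtain ⟨η, hη⟩ := exists_form_of_functional C
  refine ⟨CheckOmega.mk 1 h η, LinearMap.ext fun χ => ?_⟩
  obtain ⟨χ, rfl⟩ := restrictToD_surjective h χ
  rw [pairing_mk, restrictToD_mk, hη, ← hΨ']
  congr 1
  -- For logarithmic χ, h C(χ) = Ψ(hχ) = h Ψ(χ), so `C` does extend `Ψ`.
  refine mul_left_cancel_of_ne_zero hh.ne_zero ?_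
  refine (hc χ.1).symm.trans ?_
  rw [← smul_eq_mul, ← map_smul]
  rfl

/-- Elements of θ_D are functionals on a quotient in which dh is zero; equivalently, dh/h is a
logarithmic form. This lets functionals on Ω̌¹_D be represented by logarithmic fields. -/
theorem d_mem_hLogForms [FiniteDimensional ℂ E] {S : Set E} {h : HolFun p}
    (hh : IsReducedEquation S h) :
    d h ∈ hLogForms 1 h :=
  (mem_hLogForms_iff_thetaD hh).2 fun χ => by rw [kahlerD_mk_d, map_zero]

theorem pairing_flip_bijective [FiniteDimensional ℂ E] {S : Set E} {h : HolFun p}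
    (hh : IsReducedEquation S h) :
    Function.Bijective (pairing hh).flip := by
  constructor
  · intro χ ψ H
    refine thetaD_ext fun η => ?_
    rw [← pairing_mk hh, ← pairing_mk hh]
    exact LinearMap.congr_fun H (CheckOmega.mk 1 h η)
  · intro Φ
    obtain ⟨χ, hχ⟩ := exists_derLog_of_functional
      ((Φ.restrictScalars (HolFun p)) ∘ₗ CheckOmega.mk 1 h) (by
        have : CheckOmega.mk 1 h (d h) = 0 :=
          (Submodule.Quotient.mk_eq_zero _).2 (d_mem_hLogForms hh)
        rw [LinearMap.comp_apply, this, map_zero])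
    refine ⟨restrictToD h χ, LinearMap.ext fun x => ?_⟩
    obtain ⟨η, rfl⟩ := checkOmega_mk_surjective 1 h x
    exact hχ η

theorem pairing_isPerfPair [FiniteDimensional ℂ E] {S : Set E} {h : HolFun p}
    (hh : IsReducedEquation S h)
    [Module.Projective (HolFun p) (derLog (Ideal.span {h}))] : (pairing hh).IsPerfPair where
  bijective_left := ⟨pairing_injective hh, pairing_surjective hh⟩
  bijective_right := pairing_flip_bijective hh

end FreeDivisor

end

theorem proposition3p7 {E : Type*} [NormedAddCommGroup E] [NormedSpace ℂ E]
    [FiniteDimensional ℂ E]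
    {V : Type*} [TopologicalSpace V] [ChartedSpace E V] [IsManifold 𝓘(ℂ, E) ω V]
    (D : Set V) (hD : FreeDivisor.IsFreeDivisor E D)
    (φ : OpenPartialHomeomorph V E) (hφ : φ ∈ IsManifold.maximalAtlas 𝓘(ℂ, E) ω V)
    (x : V) (hx : x ∈ φ.source)
    (h : FreeDivisor.HolFun (φ x))
    (hh : FreeDivisor.IsReducedEquation (FreeDivisor.inChart φ D) h) :
    (∃ B : FreeDivisor.CheckOmega 1 h →ₗ[FreeDivisor.FunD h]
          FreeDivisor.ThetaD h →ₗ[FreeDivisor.FunD h] FreeDivisor.FunD h,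
        (∀ (η : FreeDivisor.Omega 1 (φ x)) (χ : FreeDivisor.ThetaD h),
          B (FreeDivisor.CheckOmega.mk 1 h η) χ = χ (FreeDivisor.KahlerD.mk h η)) ∧
        (∀ (η : FreeDivisor.Omega 1 (φ x)) (χ : FreeDivisor.derLog (Ideal.span {h})),
          B (FreeDivisor.CheckOmega.mk 1 h η) (FreeDivisor.restrictToD h χ) =
            Ideal.Quotient.mk (Ideal.span {h}) (FreeDivisor.evalForm (φ x) η χ.1)) ∧
        B.IsPerfPair) ∧
      Function.Surjective (FreeDivisor.restrictToD h) ∧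
      ∃ e : FreeDivisor.CheckOmega 1 h ≃ₗ[FreeDivisor.FunD h]
          Module.Dual (FreeDivisor.FunD h)
            (Module.Dual (FreeDivisor.FunD h) (FreeDivisor.KahlerD h)),
        ∀ η : FreeDivisor.Omega 1 (φ x),
          e (FreeDivisor.CheckOmega.mk 1 h η) =
            Module.Dual.eval (FreeDivisor.FunD h) (FreeDivisor.KahlerD h)
              (FreeDivisor.KahlerD.mk h η) := by
  have hfree := (hD φ hφ x hx).2
  -- Freeness is assumed for the vanishing ideal of D; a reduced equation identifies that ideal with
  -- (h), and free modules are projective.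
  rw [hh.generates] at hfree
  have hperf := FreeDivisor.pairing_isPerfPair hh
  exact ⟨⟨FreeDivisor.pairing hh, FreeDivisor.pairing_mk hh,
      fun η χ => FreeDivisor.pairing_mk hh η (FreeDivisor.restrictToD h χ), hperf⟩,
    FreeDivisor.restrictToD_surjective h,
    LinearEquiv.ofBijective (FreeDivisor.pairing hh) hperf.bijective_left, fun η => rfl⟩
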